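/- Let $d\ge 0$ be an integer and let $r,s\in(-1,\infty)$ with $r\neq 0$ and $r+s=0$. Write $(x)_n=x(x+1)\cdots(x+n-1)$, and let ${}_mF_n$ be the generalized hypergeometric series (a terminating series stops at its first vanishing numerator). Put $$\theta_i=(d-i)(d-i+r+s+1),\qquad b_i=(d-i)(d-i+s),\qquad c_i=i(i+r),$$ $$k_i=\frac{b_0\cdots b_{i-1}}{c_1\cdots c_i},\qquad \nu=\frac{(\theta_0-\theta_1)\cdots(\theta_0-\theta_d)}{c_1\cdots c_d},\qquad k_i^*=\frac{b_0^*\cdots b_{i-1}^*}{c_1^*\cdots c_i^*}\qquad(0\le i\le d),$$ where $$b_i^*=\frac{(d-i)(i-d-s)(2d-2i+r+s+2)_i}{(2d-2i+r+s)_{i+1}},\qquad c_i^*=\frac{i(i-d-r-1)(d-i+r+s+1)_{d-i}}{(d-i+r+s+2)_{d-i+1}}.$$ For $0\le i\le d$ let $u_i\in\mathbb R[x]$ be the unique polynomial of degree at most $d$ with $$u_i(\theta_j)={}_3F_2\left(\begin{matrix}-i,\,-j,\,j-r-s-2d-1\\-s-d,\,-d\end{matrix}\,\Big|\,1\right)\qquad(0\le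 j\le d).$$ Then the following hold. 1. The $u_i$ are dual Hahn polynomials: $u_i(x+d(d+r+s+1))=h_i(x)$ for $0\le i\le d$, where $h_i$ is the dual Hahn polynomial with parameters $(N,\gamma,\delta)=(d,-s-d-1,-r-d-1)$, i.e. the polynomial with $$h_i(x(x+\gamma+\delta+1))={}_3F_2\left(\begin{matrix}-i,\,-x,\,x+\gamma+\delta+1\\ \gamma+1,\,-N\end{matrix}\,\Big|\,1\right).$$ 2. The $u_i$ are also Racah polynomials: $u_i(4x+d(d+1))=r_i(x)$ for $0\le i\le d$, where $r_i$ is the Racah polynomial with parameters $(N,\alpha,\beta,\gamma,\delta)=(d,-d-1,r,\frac{r-d-1}{2},-\frac{r+d}{2}-1)$, i.e. the polynomial with $$r_i(x(x+\gamma+\delta+1))={}_4F_3\left(\begin{matrix}-i,\,i+\alpha+\beta+1,\,-x,\,x+\gamma+\delta+1\\ \alpha+1,\,\beta+\delta+1,\,\gamma+1\end{matrix}\,\Big|\,1\right).$$ 3. The points and weights are the same: there is a permutation $\sigma$ of $\{0,\dots,d\}$ such that for $0\le j\le d$, with the parameters $\alpha,\beta,\gamma,\delta$ of part 2 and $\bar\theta_j=(d-2j)(d-2j+1)$,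 $$4j(j+\gamma+\delta+1)+d(d+1)=\bar\theta_j=\theta_{\sigma(j)},$$ $$\frac{(\alpha+1)_j(\beta+\delta+1)_j(\gamma+1)_j(\gamma+\delta+1)_j\left(\frac{\gamma+\delta+3}{2}\right)_j}{(-\alpha+\gamma+\delta+1)_j(-\beta+\gamma+1)_j\left(\frac{\gamma+\delta+1}{2}\right)_j(\delta+1)_j\,j!}=k^*_{\sigma(j)},$$ the left-hand side of the last equation being the weight of the Racah polynomials at the point $j(j+\gamma+\delta+1)$. 4. $u_0,\dots,u_d$ are discrete orthogonal polynomials on the points $\theta_i$ with the weights $k_i^*$: the $\theta_i$ are mutually distinct, the $k_i^*$ are positive, $\deg u_i=i$, and for $0\le i,j\le d$ the sum $\sum_{h=0}^d u_i(\theta_h)u_j(\theta_h)k_h^*$ is $0$ if $i\ne j$ and is positive if $i=j$. Moreover, for $i=j$ it equals $\nu/k_i$. 5. For $0\le i,j\le d$, $$u_i(\bar\theta_j)={}_4F_3\left(\begin{matrix}-i,\,i-d+r,\,-j,\,j-d-\frac12\\ -d,\,\frac{r-d}{2},\,\frac{r-d+1}{2}\end{matrix}\,\Big|\,1\right).$$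 -/

import Mathlib

open Polynomial

namespace DualHahnRacah

/-- The Pochhammer symbol `(x)_n = x (x + 1) ⋯ (x + n - 1)`. -/
noncomputable def poch (x : ℝ) (n : ℕ) : ℝ := ∏ k ∈ Finset.range n, (x + k)

/-- The generalized hypergeometric series `ₘFₙ(as; bs | x)`. A terminating series stops at the
first vanishing numerator: from there on all its terms are zero, also where a denominator
vanishes. -/
noncomputable def hypergeom (as bs : List ℝ) (x : ℝ) : ℝ :=
  ∑' h : ℕ, (as.map fun a => poch a h).prod / (bs.map fun b => poch b h).prod
    * (x ^ h / (h.factorial : ℝ))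

/-! ### Discrete orthogonal polynomials -/

/-- The bilinear form `⟨f, g⟩ = ∑ f(θ_h) g(θ_h) w_h` of `d + 1` points and weights. -/
noncomputable def discreteForm (d : ℕ) (pt wt : Fin (d + 1) → ℝ) (f g : ℝ[X]) : ℝ :=
  ∑ h : Fin (d + 1), f.eval (pt h) * g.eval (pt h) * wt h

/-- `f_0, …, f_d` is a family of discrete orthogonal polynomials on the (mutually distinct) points
`pt` with the (positive) weights `wt`. -/
structure IsDiscreteOrthogonal (d : ℕ) (pt wt : Fin (d + 1) → ℝ)
    (f : Fin (d + 1) → ℝ[X]) : Prop where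
  distinct : Function.Injective pt
  weight_pos : ∀ h, 0 < wt h
  degree_eq : ∀ i, (f i).degree = (i : ℕ)
  orthogonal : ∀ i j, i ≠ j → discreteForm d pt wt (f i) (f j) = 0
  norm_pos : ∀ i, 0 < discreteForm d pt wt (f i) (f i)

/-! ### The parameters of the dual Hahn polynomials -/

/-- The points `θ_i`, `0 ≤ i ≤ d`. -/
noncomputable def theta (d : ℕ) (r s : ℝ) (i : ℕ) : ℝ :=
  ((d : ℝ) - i) * ((d : ℝ) - i + r + s + 1)

/-- `b_i`, `0 ≤ i ≤ d - 1`. -/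
noncomputable def bCoeff (d : ℕ) (s : ℝ) (i : ℕ) : ℝ := ((d : ℝ) - i) * ((d : ℝ) - i + s)

/-- `c_i`, `1 ≤ i ≤ d`. -/
noncomputable def cCoeff (r : ℝ) (i : ℕ) : ℝ := (i : ℝ) * (i + r)

/-- `k_i = (b_0 ⋯ b_{i-1}) / (c_1 ⋯ c_i)`, `0 ≤ i ≤ d`. -/
noncomputable def kCoeff (d : ℕ) (r s : ℝ) (i : ℕ) : ℝ :=
  (∏ h ∈ Finset.range i, bCoeff d s h) / ∏ h ∈ Finset.Icc 1 i, cCoeff r h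

/-- `ν = ((θ_0 - θ_1) ⋯ (θ_0 - θ_d)) / (c_1 ⋯ c_d)`. -/
noncomputable def nu (d : ℕ) (r s : ℝ) : ℝ :=
  (∏ h ∈ Finset.Icc 1 d, (theta d r s 0 - theta d r s h)) / ∏ h ∈ Finset.Icc 1 d, cCoeff r h

/-- `b*_i`, `0 ≤ i ≤ d - 1`. -/
noncomputable def bStar (d : ℕ) (r s : ℝ) (i : ℕ) : ℝ :=
  ((d : ℝ) - i) * ((i : ℝ) - d - s) * poch (2 * d - 2 * i + r + s + 2) i
    / poch (2 * d - 2 * i + r + s) (i + 1)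

/-- `c*_i`, `1 ≤ i ≤ d`. -/
noncomputable def cStar (d : ℕ) (r s : ℝ) (i : ℕ) : ℝ :=
  (i : ℝ) * ((i : ℝ) - d - r - 1) * poch ((d : ℝ) - i + r + s + 1) (d - i)
    / poch ((d : ℝ) - i + r + s + 2) (d - i + 1)

/-- The weights `k*_i = (b*_0 ⋯ b*_{i-1}) / (c*_1 ⋯ c*_i)`, `0 ≤ i ≤ d`. -/
noncomputable def kStar (d : ℕ) (r s : ℝ) (i : ℕ) : ℝ :=
  (∏ h ∈ Finset.range i, bStar d r s h) / ∏ h ∈ Finset.Icc 1 i, cStar d r s h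

/-- The polynomial `u_i`: the polynomial of degree at most `d` with
`u_i(θ_j) = ₃F₂(-i, -j, j - r - s - 2d - 1; -s - d, -d | 1)` for `0 ≤ j ≤ d`. -/
noncomputable def uPoly (d : ℕ) (r s : ℝ) (i : ℕ) : ℝ[X] :=
  Lagrange.interpolate (Finset.range (d + 1)) (theta d r s) fun j =>
    hypergeom [-(i : ℝ), -(j : ℝ), j - r - s - 2 * d - 1] [-s - d, -(d : ℝ)] 1

theorem theta_injOn (d : ℕ) {r s : ℝ} (hr : -1 < r) (hs : -1 < s) :
    Set.InjOn (theta d r s) (Finset.range (d + 1)) := by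
  intro i hi j hj h
  simp only [Finset.coe_range, Set.mem_Iio] at hi hj
  have hi' : (i : ℝ) ≤ d := by exact_mod_cast Nat.lt_succ_iff.mp hi
  have hj' : (j : ℝ) ≤ d := by exact_mod_cast Nat.lt_succ_iff.mp hj
  have key : ((i : ℝ) - j) * (((d : ℝ) - i) + ((d : ℝ) - j) + r + s + 1) = 0 := by
    unfold theta at h
    linarith
  rcases mul_eq_zero.mp key with h0 | h0
  · exact_mod_cast sub_eq_zero.mp h0
  · by_contra hne
    rcases Nat.lt_or_gt_of_ne hne with hlt | hlt
    · have : (i : ℝ) + 1 ≤ j := by exact_mod_cast hlt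
      linarith
    · have : (j : ℝ) + 1 ≤ i := by exact_mod_cast hlt
      linarith

/-- `u_i` is well defined: it is the unique polynomial of degree at most `d` with the given
values. -/
theorem uPoly_unique (d : ℕ) {r s : ℝ} (hr : -1 < r) (hs : -1 < s) (i : ℕ) (f : ℝ[X]) :
    f = uPoly d r s i ↔ f.degree ≤ d ∧ ∀ j ≤ d, f.eval (theta d r s j) =
      hypergeom [-(i : ℝ), -(j : ℝ), j - r - s - 2 * d - 1] [-s - d, -(d : ℝ)] 1 := by
  have hinj := theta_injOn d hr hs
  constructor
  · rintro rfl
    refine ⟨?_, fun j hj => ?_⟩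
    · have := Lagrange.degree_interpolate_le (fun j : ℕ => hypergeom
        [-(i : ℝ), -(j : ℝ), j - r - s - 2 * d - 1] [-s - d, -(d : ℝ)] 1) hinj
      simpa [uPoly] using this
    · exact Lagrange.eval_interpolate_at_node _ hinj (by simpa [Nat.lt_succ_iff] using hj)
  · rintro ⟨hdeg, hval⟩
    refine Lagrange.eq_interpolate_of_eval_eq _ hinj ?_ fun j hj => ?_
    · refine lt_of_le_of_lt hdeg ?_
      rw [Finset.card_range]
      exact_mod_cast Nat.lt_succ_self d
    · exact hval j (by simpa [Nat.lt_succ_iff] using hj)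

/-! ### The dual Hahn and the Racah polynomials of the Askey scheme -/

/-- `(-x)_h (x + c)_h` as a polynomial in the variable `x (x + c)`. -/
noncomputable def quadPoch (c : ℝ) (h : ℕ) : ℝ[X] :=
  ∏ k ∈ Finset.range h, (C ((k : ℝ) * (c + k)) - X)

/-- The dual Hahn polynomial `R_n` with parameters `γ, δ, N`, a polynomial in
`λ(x) = x (x + γ + δ + 1)`: see `dualHahnPoly_eval`. -/
noncomputable def dualHahnPoly (γ δ : ℝ) (N n : ℕ) : ℝ[X] :=
  ∑ h ∈ Finset.range (n + 1),
    C (poch (-(n : ℝ)) h / (poch (γ + 1) h * poch (-(N : ℝ)) h * h.factorial))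
      * quadPoch (γ + δ + 1) h

/-- The quadratic lattice `λ(x) = x (x + γ + δ + 1)` of the Racah polynomials. -/
noncomputable def racahLattice (γ δ x : ℝ) : ℝ := x * (x + γ + δ + 1)

/-- The Racah polynomial `R_n` with parameters `α, β, γ, δ` (where one of `α + 1`, `β + δ + 1`,
`γ + 1` is to be `-N` and `0 ≤ n ≤ N`), a polynomial in `λ(x) = x (x + γ + δ + 1)`:
see `racahPoly_eval`. -/
noncomputable def racahPoly (α β γ δ : ℝ) (n : ℕ) : ℝ[X] :=
  ∑ h ∈ Finset.range (n + 1),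
    C (poch (-(n : ℝ)) h * poch (n + α + β + 1) h
        / (poch (α + 1) h * poch (β + δ + 1) h * poch (γ + 1) h * h.factorial))
      * quadPoch (γ + δ + 1) h

/-- The weight of the Racah polynomials at the point `λ(x)`, `x = 0, …, N`. -/
noncomputable def racahWeight (α β γ δ : ℝ) (x : ℕ) : ℝ :=
  (poch (α + 1) x * poch (β + δ + 1) x * poch (γ + 1) x * poch (γ + δ + 1) x
      * poch ((γ + δ + 3) / 2) x)
    / (poch (-α + γ + δ + 1) x * poch (-β + γ + 1) x * poch ((γ + δ + 1) / 2) x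
      * poch (δ + 1) x * x.factorial)

theorem poch_neg_eq_zero {n h : ℕ} (hh : n < h) : poch (-(n : ℝ)) h = 0 :=
  Finset.prod_eq_zero (Finset.mem_range.mpr hh) (neg_add_cancel _)

theorem quadPoch_eval (c x : ℝ) (h : ℕ) :
    (quadPoch c h).eval (x * (x + c)) = poch (-x) h * poch (x + c) h := by
  simp only [quadPoch, poch, eval_prod, ← Finset.prod_mul_distrib]
  refine Finset.prod_congr rfl fun k _ => ?_
  simp only [eval_sub, eval_C, eval_X]
  ring

/-- `R_n(λ(x)) = ₃F₂(-n, -x, x + γ + δ + 1; γ + 1, -N | 1)`. -/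
theorem dualHahnPoly_eval (γ δ : ℝ) (N n : ℕ) (x : ℝ) :
    (dualHahnPoly γ δ N n).eval (x * (x + γ + δ + 1)) =
      hypergeom [-(n : ℝ), -x, x + γ + δ + 1] [γ + 1, -(N : ℝ)] 1 := by
  have hx : x + γ + δ + 1 = x + (γ + δ + 1) := by ring
  rw [hypergeom, tsum_eq_sum (s := Finset.range (n + 1)), dualHahnPoly, eval_finsetSum]
  · refine Finset.sum_congr rfl fun h _ => ?_
    rw [hx, eval_mul, eval_C, quadPoch_eval]
    simp only [List.map_cons, List.map_nil, List.prod_cons, List.prod_nil, one_pow, mul_one,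
      div_eq_mul_inv, mul_inv, one_mul]
    ring
  · intro h hh
    rw [Finset.mem_range, not_lt] at hh
    simp [poch_neg_eq_zero (Nat.lt_of_succ_le hh)]

/-- `R_n(λ(x)) = ₄F₃(-n, n + α + β + 1, -x, x + γ + δ + 1; α + 1, β + δ + 1, γ + 1 | 1)`. -/
theorem racahPoly_eval (α β γ δ : ℝ) (n : ℕ) (x : ℝ) :
    (racahPoly α β γ δ n).eval (racahLattice γ δ x) =
      hypergeom [-(n : ℝ), n + α + β + 1, -x, x + γ + δ + 1] [α + 1, β + δ + 1, γ + 1] 1 := by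
  have hx : x + γ + δ + 1 = x + (γ + δ + 1) := by ring
  rw [hypergeom, tsum_eq_sum (s := Finset.range (n + 1)), racahPoly, eval_finsetSum]
  · refine Finset.sum_congr rfl fun h _ => ?_
    rw [racahLattice, hx, eval_mul, eval_C, quadPoch_eval]
    simp only [List.map_cons, List.map_nil, List.prod_cons, List.prod_nil, one_pow, mul_one,
      div_eq_mul_inv, mul_inv, one_mul]
    ring
  · intro h hh
    rw [Finset.mem_range, not_lt] at hh
    simp [poch_neg_eq_zero (Nat.lt_of_succ_le hh)]

/-- The points `θ̄_i = (d - 2i)(d - 2i + 1)`, `0 ≤ i ≤ d`. -/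
noncomputable def thetaBar (d : ℕ) (i : ℕ) : ℝ :=
  ((d : ℝ) - 2 * i) * ((d : ℝ) - 2 * i + 1)

end DualHahnRacah

open DualHahnRacah

namespace DualHahnRacah

/-! Here s = -r, so -1 < r < 1 and r ≠ 0. Hence r is not an integer, and no Pochhammer denominator
involving r vanishes. Put λ_k = k(k - 2d - 1), so that θ_k = λ_k + d(d+1).

The coincidence of the two families comes from the three-term recurrence in the index. Expanded in
the Newton basis on the nodes λ_k, the dual Hahn polynomials satisfy a recurrence with coefficients
(d-n)(d-n-r) and n(n+r). The Racah polynomials, in the Newton basis on k(k - d - 1/2), satisfy the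
same recurrence with both coefficients divided by 4. Both families start at 1, so they agree by
induction, one taken at 4x and the other at x (`dh_eq_ra`). Four times the k-th Racah node is
λ_{2k}, and λ is invariant under k ↦ 2d+1-k, so the two point sets agree up to order. A closed form
of k*_i with the same symmetry (`kStarClosed_symm`) matches the weights.

Orthogonality is first proved in its dual form, summed over the index. `christoffel_darboux`, closed
up by the recurrence at index d, turns ∑ k_n u_n(x) u_n(θ_h) into a multiple of the product over the
nodes other than θ_h. It vanishes at those nodes. At θ_h, Chu–Vandermonde and a factorial product
give ν/k*_h. This says that one square matrix is a right inverse of another. It is then also a left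
inverse, which is orthogonality over the points. -/

/-! ### Pochhammer symbols. -/

theorem poch_zero (x : ℝ) : poch x 0 = 1 := by simp [poch]

theorem poch_succ (x : ℝ) (n : ℕ) : poch x (n + 1) = poch x n * (x + n) :=
  Finset.prod_range_succ _ _

theorem poch_succ_left (x : ℝ) (n : ℕ) : poch x (n + 1) = x * poch (x + 1) n := by
  rw [poch, Finset.prod_range_succ', mul_comm]
  simp only [Nat.cast_zero, add_zero, poch]
  congr 1
  exact Finset.prod_congr rfl fun k _ => by push_cast; ring

theorem poch_ne_zero {x : ℝ} {n : ℕ} (h : ∀ k < n, x + k ≠ 0) : poch x n ≠ 0 :=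
  Finset.prod_ne_zero_iff.mpr fun k hk => h k (Finset.mem_range.mp hk)

theorem poch_pos {x : ℝ} (hx : 0 < x) (n : ℕ) : 0 < poch x n :=
  Finset.prod_pos fun _ _ => by positivity

/-- Reversal of the factors of a Pochhammer symbol. -/
theorem poch_reverse (x : ℝ) (n : ℕ) : poch (1 - x - n) n = (-1) ^ n * poch x n := by
  induction n generalizing x with
  | zero => simp [poch_zero]
  | succ n ih =>
    rw [poch_succ_left, poch_succ, pow_succ]
    have h : 1 - x - ((n + 1 : ℕ) : ℝ) + 1 = 1 - x - n := by push_cast; ring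
    rw [h, ih]
    push_cast
    ring

theorem poch_add (x : ℝ) (m n : ℕ) : poch x (m + n) = poch x m * poch (x + m) n := by
  rw [poch, Finset.prod_range_add]
  simp only [poch, Nat.cast_add, add_assoc]

theorem poch_neg_ne_zero {n h : ℕ} (hh : h ≤ n) : poch (-(n : ℝ)) h ≠ 0 := by
  refine poch_ne_zero fun k hk => ?_
  have : (k : ℝ) < n := by exact_mod_cast hk.trans_le hh
  linarith

/-- A real number strictly between `-1` and `1`, other than `0`, is not an integer. -/
theorem ne_intCast_of_abs_lt_one {r : ℝ} (h1 : -1 < r) (h2 : r < 1) (h0 : r ≠ 0) (m : ℤ) :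
    r ≠ m := by
  rintro rfl
  have h1' : -1 < m := by exact_mod_cast h1
  have h2' : m < 1 := by exact_mod_cast h2
  have : m = 0 := by omega
  exact h0 (by simp [this])

/-! ### Newton expansions, three-term recurrences and the quadratic transformation. -/

/-- The Newton sum `∑ a_h (x_0 - x) ⋯ (x_{h-1} - x)`, `0 ≤ h ≤ M`. -/
noncomputable def newtonSum (M : ℕ) (node a : ℕ → ℝ) (x : ℝ) : ℝ :=
  ∑ h ∈ Finset.range (M + 1), a h * ∏ k ∈ Finset.range h, (node k - x)

/-- A three-term relation between coefficients is one between Newton sums, up to the top term. -/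
theorem newtonSum_recurrence (M : ℕ) (node a₀ a₁ a₂ : ℕ → ℝ) (A B x : ℝ)
    (h0 : A * (a₂ 0 - a₁ 0) - B * (a₁ 0 - a₀ 0) = node 0 * a₁ 0)
    (hstep : ∀ h < M, A * (a₂ (h + 1) - a₁ (h + 1)) - B * (a₁ (h + 1) - a₀ (h + 1)) =
      node (h + 1) * a₁ (h + 1) - a₁ h) :
    A * (newtonSum M node a₂ x - newtonSum M node a₁ x)
      - B * (newtonSum M node a₁ x - newtonSum M node a₀ x) - x * newtonSum M node a₁ x =
    a₁ M * ∏ k ∈ Finset.range (M + 1), (node k - x) := by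
  -- With φ_h = ∏_{k<h} (node_k - x), one has x φ_h = node_h φ_h - φ_{h+1}. So x times the sum has
  -- coefficient node_h a_h - a_{h-1} at φ_h, and only the top φ_{M+1} is left over.
  induction M with
  | zero =>
    simp only [newtonSum, zero_add, Finset.sum_range_one, Finset.prod_range_zero,
      Finset.prod_range_one, mul_one]
    linear_combination h0
  | succ M ih =>
    have ih' := ih fun h hh => hstep h (Nat.lt_succ_of_lt hh)
    have hs := hstep M (Nat.lt_succ_self M)
    have e (a : ℕ → ℝ) : newtonSum (M + 1) node a x = newtonSum M node a x +
      a (M + 1) * ∏ k ∈ Finset.range (M + 1), (node k - x) := Finset.sum_range_succ _ _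
    rw [e, e, e, Finset.prod_range_succ _ (M + 1)]
    linear_combination ih' + (∏ k ∈ Finset.range (M + 1), (node k - x)) * hs

/-- The coefficients of the dual Hahn polynomials with parameters `r - d - 1`, `-r - d - 1`, `d`
(at a real index). -/
noncomputable def dhCoeff (d : ℕ) (r t : ℝ) (h : ℕ) : ℝ :=
  poch (-t) h / (poch (r - d) h * poch (-(d : ℝ)) h * h.factorial)

/-- The coefficients of the Racah polynomials with parameters `-d - 1`, `r`, `(r - d - 1) / 2`,
`-(r + d) / 2 - 1` (at a real index). -/
noncomputable def raCoeff (d : ℕ) (r t : ℝ) (h : ℕ) : ℝ :=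
  poch (-t) h * poch (t + r - d) h /
    (poch (-(d : ℝ)) h * poch ((r - d) / 2) h * poch ((r - d + 1) / 2) h * h.factorial)

/-- Invariant under k ↦ 2d+1-k, and equal to θ_k - d(d+1) when s = -r. -/
noncomputable def dhNode (d k : ℕ) : ℝ := k * (k - 2 * d - 1)

/-- Four times this value is `dhNode d (2 * k)`. -/
noncomputable def raNode (d k : ℕ) : ℝ := k * (k - d - 1 / 2)

/-- Once (-t)_h over the common Pochhammer denominators is factored out, a rational identity in t,
h, d, r remains. The index t is real so that t - 1 makes sense at t = 0. -/
theorem dhCoeff_recurrence (d : ℕ) {r : ℝ} (hr : ∀ m : ℤ, r ≠ m) (t : ℝ) {h : ℕ} (hh : h < d) :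
    ((d - t) * (d - t - r)) * (dhCoeff d r (t + 1) (h + 1) - dhCoeff d r t (h + 1))
      - (t * (t + r)) * (dhCoeff d r t (h + 1) - dhCoeff d r (t - 1) (h + 1)) =
    dhNode d (h + 1) * dhCoeff d r t (h + 1) - dhCoeff d r t h := by
  have h1 : poch (r - d) h ≠ 0 := poch_ne_zero fun k _ e =>
    hr (d - k) (by push_cast; linarith)
  have h2 : poch (-(d : ℝ)) h ≠ 0 := poch_neg_ne_zero hh.le
  have h3 : r - d + h ≠ 0 := fun e => hr (d - h) (by push_cast; linarith)
  have h4 : -(d : ℝ) + h ≠ 0 := by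
    have : (h : ℝ) < d := by exact_mod_cast hh
    linarith
  have h5 : (h.factorial : ℝ) ≠ 0 := by positivity
  have h6 : (h : ℝ) + 1 ≠ 0 := by positivity
  have p1 : poch (-(t + 1)) (h + 1) = -(t + 1) * poch (-t) h := by
    rw [poch_succ_left]; congr 2; ring
  -- The factor t of t(t+r) completes (1-t)_{h+1} to -(-t)_{h+2}, which contains (-t)_h. No division
  -- by t is needed.
  have p2 : t * poch (-(t - 1)) (h + 1) = -(poch (-t) h * (-t + h) * (-t + h + 1)) := by
    have := poch_succ_left (-t) (h + 1)
    rw [poch_succ, poch_succ] at this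
    have e : -(t - 1) = -t + 1 := by ring
    rw [e]
    push_cast at this
    linear_combination this
  have p3 : t * dhCoeff d r (t - 1) (h + 1) =
      -(poch (-t) h * (-t + h) * (-t + h + 1)) /
        (poch (r - d) (h + 1) * poch (-(d : ℝ)) (h + 1) * (h + 1).factorial) := by
    rw [dhCoeff, ← mul_div_assoc, p2]
  have : ((d - t) * (d - t - r)) * (dhCoeff d r (t + 1) (h + 1) - dhCoeff d r t (h + 1))
      - (t * (t + r)) * dhCoeff d r t (h + 1) + (t + r) * (t * dhCoeff d r (t - 1) (h + 1)) =
    dhNode d (h + 1) * dhCoeff d r t (h + 1) - dhCoeff d r t h := by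
    rw [p3, dhCoeff, dhCoeff, dhCoeff, p1, dhNode]
    simp only [poch_succ, Nat.factorial_succ]
    push_cast
    field_simp
    ring
  linear_combination this

theorem raCoeff_recurrence (d : ℕ) {r : ℝ} (hr : ∀ m : ℤ, r ≠ m) (t : ℝ) {h : ℕ} (hh : h < d) :
    ((d - t) * (d - t - r) / 4) * (raCoeff d r (t + 1) (h + 1) - raCoeff d r t (h + 1))
      - (t * (t + r) / 4) * (raCoeff d r t (h + 1) - raCoeff d r (t - 1) (h + 1)) =
    raNode d (h + 1) * raCoeff d r t (h + 1) - raCoeff d r t h := by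
  have h1 : poch ((r - d) / 2) h ≠ 0 := poch_ne_zero fun k _ e =>
    hr (d - 2 * k) (by push_cast; linarith)
  have h1' : poch ((r - d + 1) / 2) h ≠ 0 := poch_ne_zero fun k _ e =>
    hr (d - 1 - 2 * k) (by push_cast; linarith)
  have h2 : poch (-(d : ℝ)) h ≠ 0 := poch_neg_ne_zero hh.le
  have h3 : r - d + 2 * h ≠ 0 := fun e => hr (d - 2 * h) (by push_cast; linarith)
  have h3' : r - d + 1 + 2 * h ≠ 0 := fun e => hr (d - 1 - 2 * h) (by push_cast; linarith)
  have h4 : -(d : ℝ) + h ≠ 0 := by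
    have : (h : ℝ) < d := by exact_mod_cast hh
    linarith
  have h5 : (h.factorial : ℝ) ≠ 0 := by positivity
  have h6 : (h : ℝ) + 1 ≠ 0 := by positivity
  obtain ⟨u, hu⟩ : ∃ u, u = r - d + 2 * h := ⟨_, rfl⟩
  obtain ⟨v, hv⟩ : ∃ v, v = r - d + 1 + 2 * h := ⟨_, rfl⟩
  obtain ⟨w, hw⟩ : ∃ w, w = -(d : ℝ) + h := ⟨_, rfl⟩
  rw [← hu] at h3
  rw [← hv] at h3'
  rw [← hw] at h4
  have e3 : (r - d) / 2 + h = u / 2 := by rw [hu]; ring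
  have e3' : (r - d + 1) / 2 + h = v / 2 := by rw [hv]; ring
  have p1 : poch (-(t + 1)) (h + 1) = -(t + 1) * poch (-t) h := by
    rw [poch_succ_left]; congr 2; ring
  -- The factor d - t - r of the recurrence coefficient plays, up to sign, the same role for the
  -- shifted second Pochhammer symbol.
  have p1' : (t + r - d) * poch (t + 1 + r - d) (h + 1) =
      poch (t + r - d) h * (t + r - d + h) * (t + r - d + h + 1) := by
    have := poch_succ_left (t + r - d) (h + 1)
    rw [poch_succ, poch_succ] at this
    have e : t + 1 + r - d = t + r - d + 1 := by ring
    rw [e]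
    push_cast at this
    linear_combination -this
  have p2 : t * poch (-(t - 1)) (h + 1) = -(poch (-t) h * (-t + h) * (-t + h + 1)) := by
    have := poch_succ_left (-t) (h + 1)
    rw [poch_succ, poch_succ] at this
    have e : -(t - 1) = -t + 1 := by ring
    rw [e]
    push_cast at this
    linear_combination this
  have p2' : poch (t - 1 + r - d) (h + 1) = (t - 1 + r - d) * poch (t + r - d) h := by
    rw [poch_succ_left]; congr 2; ring
  have p3 : t * raCoeff d r (t - 1) (h + 1) =
      -(poch (-t) h * (-t + h) * (-t + h + 1)) * ((t - 1 + r - d) * poch (t + r - d) h) /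
        (poch (-(d : ℝ)) (h + 1) * poch ((r - d) / 2) (h + 1) * poch ((r - d + 1) / 2) (h + 1)
          * (h + 1).factorial) := by
    rw [raCoeff, ← mul_div_assoc, ← mul_assoc, p2, p2']
  have p4 : (t + r - d) * raCoeff d r (t + 1) (h + 1) =
      (-(t + 1) * poch (-t) h) * (poch (t + r - d) h * (t + r - d + h) * (t + r - d + h + 1)) /
        (poch (-(d : ℝ)) (h + 1) * poch ((r - d) / 2) (h + 1) * poch ((r - d + 1) / 2) (h + 1)
          * (h + 1).factorial) := by
    rw [raCoeff, ← mul_div_assoc, p1, ← p1']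
    ring
  have : -((d - t) / 4) * ((t + r - d) * raCoeff d r (t + 1) (h + 1))
      - ((d - t) * (d - t - r) / 4) * raCoeff d r t (h + 1)
      - (t * (t + r) / 4) * raCoeff d r t (h + 1)
      + ((t + r) / 4) * (t * raCoeff d r (t - 1) (h + 1)) =
    raNode d (h + 1) * raCoeff d r t (h + 1) - raCoeff d r t h := by
    rw [p3, p4, raCoeff, raCoeff, raNode]
    simp only [poch_succ, Nat.factorial_succ, e3, e3', ← hw]
    push_cast
    field_simp
    rw [hu, hv, hw]
    ring
  linear_combination this

/-- The three-term recurrence of the dual Hahn polynomials, up to a multiple of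
`∏ (λ_k - x)`. -/
theorem dh_recurrence (d : ℕ) {r : ℝ} (hr : ∀ m : ℤ, r ≠ m) (t x : ℝ) :
    ((d - t) * (d - t - r)) * (newtonSum d (dhNode d) (dhCoeff d r (t + 1)) x
        - newtonSum d (dhNode d) (dhCoeff d r t) x)
      - (t * (t + r)) * (newtonSum d (dhNode d) (dhCoeff d r t) x
        - newtonSum d (dhNode d) (dhCoeff d r (t - 1)) x)
      - x * newtonSum d (dhNode d) (dhCoeff d r t) x =
    dhCoeff d r t d * ∏ k ∈ Finset.range (d + 1), (dhNode d k - x) :=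
  newtonSum_recurrence _ _ _ _ _ _ _ _ (by simp [dhCoeff, dhNode, poch_zero])
    fun _ hh => dhCoeff_recurrence d hr t hh

theorem ra_recurrence (d : ℕ) {r : ℝ} (hr : ∀ m : ℤ, r ≠ m) (t x : ℝ) :
    ((d - t) * (d - t - r) / 4) * (newtonSum d (raNode d) (raCoeff d r (t + 1)) x
        - newtonSum d (raNode d) (raCoeff d r t) x)
      - (t * (t + r) / 4) * (newtonSum d (raNode d) (raCoeff d r t) x
        - newtonSum d (raNode d) (raCoeff d r (t - 1)) x)
      - x * newtonSum d (raNode d) (raCoeff d r t) x =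
    raCoeff d r t d * ∏ k ∈ Finset.range (d + 1), (raNode d k - x) :=
  newtonSum_recurrence _ _ _ _ _ _ _ _ (by simp [raCoeff, raNode, poch_zero])
    fun _ hh => raCoeff_recurrence d hr t hh

theorem dhCoeff_eq_zero (d : ℕ) (r : ℝ) {n h : ℕ} (hn : n < h) : dhCoeff d r n h = 0 := by
  rw [dhCoeff, poch_neg_eq_zero hn, zero_div]

theorem raCoeff_eq_zero (d : ℕ) (r : ℝ) {n h : ℕ} (hn : n < h) : raCoeff d r n h = 0 := by
  rw [raCoeff, poch_neg_eq_zero hn, zero_mul, zero_div]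

/-- The quadratic transformation between dual Hahn and Racah polynomials. -/
theorem dh_eq_ra (d : ℕ) {r : ℝ} (hr : ∀ m : ℤ, r ≠ m) {n : ℕ} (hn : n ≤ d) (x : ℝ) :
    newtonSum d (dhNode d) (dhCoeff d r n) (4 * x) = newtonSum d (raNode d) (raCoeff d r n) x := by
  induction n using Nat.strong_induction_on with
  | _ n ih =>
    rcases n with _ | n
    · have (node : ℕ → ℝ) (a : ℕ → ℝ) (y : ℝ) (h0 : a 0 = 1) (h1 : ∀ h, 0 < h → a h = 0) :
          newtonSum d node a y = 1 := by
        rw [newtonSum, Finset.sum_eq_single 0]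
        · simp [h0]
        · intro h _ hh
          rw [h1 h (Nat.pos_of_ne_zero hh), zero_mul]
        · simp
      rw [this, this]
      · simp [raCoeff, poch_zero]
      · exact fun h hh => raCoeff_eq_zero d r hh
      · simp [dhCoeff, poch_zero]
      · exact fun h hh => dhCoeff_eq_zero d r hh
    · have e1 := dh_recurrence d hr n (4 * x)
      have e2 := ra_recurrence d hr n x
      -- The remainder has the factor (-n)_d, which vanishes because n < d.
      rw [dhCoeff_eq_zero d r hn, zero_mul] at e1
      rw [raCoeff_eq_zero d r hn, zero_mul] at e2
      have i1 := ih n (Nat.lt_succ_self n) (by omega)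
      -- At n = 0 the index n - 1 is the real number -1, where no agreement of the two sums is
      -- known. The factor n removes that case.
      have i0 : (n : ℝ) * newtonSum d (dhNode d) (dhCoeff d r (n - 1)) (4 * x) =
          n * newtonSum d (raNode d) (raCoeff d r (n - 1)) x := by
        rcases n with _ | n
        · simp
        · have := ih n (by omega) (by omega)
          have e : ((n + 1 : ℕ) : ℝ) - 1 = n := by push_cast; ring
          rw [e, this]
      have hA : ((d : ℝ) - n) * (d - n - r) ≠ 0 := by
        refine mul_ne_zero ?_ fun e => hr (d - n) (by push_cast; linarith)
        have : (n : ℝ) < d := by exact_mod_cast hn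
        linarith
      push_cast
      refine mul_left_cancel₀ hA ?_
      rw [i1] at e1
      linear_combination e1 - 4 * e2 - (n + r) * i0

/-! ### The weights in closed form, and the Racah weights. -/

/-- The closed form of the weights `k*_i` in the case `r + s = 0`. -/
noncomputable def kStarClosed (d : ℕ) (r : ℝ) (i : ℕ) : ℝ :=
  poch (r - d) i / poch (-r - d) i * ((2 * d - 2 * i + 1) / (2 * d + 1)) * ((2 * d + 1).choose i)

/-- With y = 2(d - i), which is positive as i < d, the quotient (y+2)_i / (y)_{i+1} telescopes to
(y+i+1) / (y(y+1)). -/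
theorem bStar_eq {d i : ℕ} (r : ℝ) (hi : i < d) :
    bStar d r (-r) i = (i - d + r) * (2 * d - i + 1) / (2 * (2 * d - 2 * i + 1)) := by
  obtain ⟨m, rfl⟩ := Nat.exists_eq_add_of_lt hi
  obtain ⟨y, hy⟩ : ∃ y : ℝ, y = 2 * m + 2 := ⟨_, rfl⟩
  have hy0 : 0 < y := by rw [hy]; positivity
  have e1 : (2 * ((i + m + 1 : ℕ) : ℝ) - 2 * i + r + -r + 2) = y + 1 + 1 := by
    rw [hy]; push_cast; ring
  have e2 : (2 * ((i + m + 1 : ℕ) : ℝ) - 2 * i + r + -r) = y := by rw [hy]; push_cast; ring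
  have key : y * ((y + 1) * poch (y + 1 + 1) i) = poch y (i + 1) * (y + i + 1) := by
    rw [← poch_succ_left, ← poch_succ_left, poch_succ]
    push_cast
    ring
  have hp := poch_pos hy0 (i + 1)
  rw [bStar, e1, e2, div_eq_div_iff hp.ne' (by push_cast; ring_nf; positivity)]
  have h2 : ((i + m + 1 : ℕ) : ℝ) - i = y / 2 := by rw [hy]; push_cast; ring
  have h3 : (2 * (2 * ((i + m + 1 : ℕ) : ℝ) - 2 * i + 1)) = 2 * (y + 1) := by
    rw [hy]; push_cast; ring
  have h4 : (2 * ((i + m + 1 : ℕ) : ℝ) - i + 1) = y + i + 1 := by rw [hy]; push_cast; ring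
  rw [h2, h3, h4]
  linear_combination ((i : ℝ) - (i + m + 1 : ℕ) + r) * key

/-- With m = d - i, the quotient (m+1)_m / (m+2)_{m+1} telescopes to 1 / (2(2m+1)). -/
theorem cStar_eq {d i : ℕ} (r : ℝ) (hi : i ≤ d) :
    cStar d r (-r) i = i * (i - d - r - 1) / (2 * (2 * d - 2 * i + 1)) := by
  obtain ⟨m, rfl⟩ := Nat.exists_eq_add_of_le hi
  have e1 : ((i + m : ℕ) : ℝ) - i + r + -r + 1 = m + 1 := by push_cast; ring
  have e2 : ((i + m : ℕ) : ℝ) - i + r + -r + 2 = m + 1 + 1 := by push_cast; ring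
  have e3 : i + m - i = m := by omega
  have key : ((m : ℝ) + 1) * poch (m + 1 + 1) (m + 1) =
      poch (m + 1) m * (2 * m + 1) * (2 * (m + 1)) := by
    rw [← poch_succ_left, poch_succ, poch_succ]
    push_cast
    ring
  have hp : 0 < poch ((m : ℝ) + 1 + 1) (m + 1) := poch_pos (by positivity) _
  rw [cStar, e1, e2, e3, div_eq_div_iff hp.ne' (by push_cast; ring_nf; positivity)]
  have h3 : (2 * (2 * ((i + m : ℕ) : ℝ) - 2 * i + 1)) = 2 * (2 * m + 1) := by
    push_cast; ring
  have key' : poch ((m : ℝ) + 1 + 1) (m + 1) = poch (m + 1) m * (2 * m + 1) * 2 := by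
    have : (m : ℝ) + 1 ≠ 0 := by positivity
    exact mul_left_cancel₀ this (by linear_combination key)
  rw [h3, key']
  ring

theorem cast_choose_succ {n i : ℕ} (hi : i ≤ n) :
    ((n.choose (i + 1) : ℕ) : ℝ) = n.choose i * (n - i) / (i + 1) := by
  have := Nat.choose_succ_right_eq n i
  rw [eq_div_iff (by positivity), ← Nat.cast_sub hi]
  exact_mod_cast this

theorem kStar_eq {d i : ℕ} {r : ℝ} (hr : ∀ m : ℤ, r ≠ m) (hi : i ≤ d) :
    kStar d r (-r) i = kStarClosed d r i := by
  induction i with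
  | zero =>
    have : (2 * (d : ℝ) + 1) ≠ 0 := by positivity
    simp [kStar, kStarClosed, poch_zero, this]
  | succ i ih =>
    have hstep : kStar d r (-r) (i + 1) =
        kStar d r (-r) i * (bStar d r (-r) i / cStar d r (-r) (i + 1)) := by
      rw [kStar, kStar, Finset.prod_range_succ, Finset.prod_Icc_succ_top (by omega),
        mul_div_mul_comm]
    have hid : (i : ℝ) + 1 ≤ d := by exact_mod_cast hi
    rw [hstep, ih (by omega), bStar_eq r hi, cStar_eq r hi, kStarClosed, kStarClosed,
      cast_choose_succ (by omega), poch_succ, poch_succ]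
    obtain ⟨u, hu⟩ : ∃ u : ℝ, u = -r - d + i := ⟨_, rfl⟩
    obtain ⟨v, hv⟩ : ∃ v : ℝ, v = 2 * d - 2 * i + 1 := ⟨_, rfl⟩
    obtain ⟨w, hw⟩ : ∃ w : ℝ, w = 2 * d - 2 * (i + 1 : ℕ) + 1 := ⟨_, rfl⟩
    have hu' : ((i + 1 : ℕ) : ℝ) - d - r - 1 = u := by rw [hu]; push_cast; ring
    have hu0 : u ≠ 0 := fun e => hr (i - d) (by push_cast; linarith)
    have hv0 : v ≠ 0 := by rw [hv]; linarith
    have hw0 : w ≠ 0 := by rw [hw]; push_cast; linarith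
    have hd0 : (2 * (d : ℝ) + 1) ≠ 0 := by positivity
    have hi0 : (i : ℝ) + 1 ≠ 0 := by positivity
    have hp : poch (-r - d) i ≠ 0 := poch_ne_zero fun k _ e =>
      hr (k - d) (by push_cast; linarith)
    rw [hu', ← hu, ← hv, ← hw]
    push_cast
    field_simp
    ring

/-- The binomial coefficient is symmetric, while 2d - 2i + 1 and the Pochhammer quotient both change
sign. The second sign arises because reversing (r-d)_{2d+1} gives (-r-d)_{2d+1} with an odd number
of factors. -/
theorem kStarClosed_symm {d i : ℕ} {r : ℝ} (hr : ∀ m : ℤ, r ≠ m) (hi : i ≤ 2 * d + 1) :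
    kStarClosed d r (2 * d + 1 - i) = kStarClosed d r i := by
  obtain ⟨m, hm⟩ := Nat.exists_eq_add_of_le hi
  have hm' : (2 * d + 1 : ℝ) = i + m := by exact_mod_cast hm
  have hsub : 2 * d + 1 - i = m := by omega
  have e1 (x : ℝ) : poch (x - d) m * ((-1) ^ i * poch (-x - d) i) = poch (x - d) (2 * d + 1) := by
    rw [hm, add_comm i m, poch_add, ← poch_reverse]
    congr 2
    linarith
  have e2 : poch (-r - d) (2 * d + 1) = -poch (r - d) (2 * d + 1) := by
    have := poch_reverse (r - d) (2 * d + 1)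
    rw [show 1 - (r - d) - ((2 * d + 1 : ℕ) : ℝ) = -r - d by push_cast; ring] at this
    rw [this, pow_succ, pow_mul]
    norm_num
  have e3 := e1 r
  have e4 := e1 (-r)
  rw [neg_neg, e2, ← e3] at e4
  have hs : ((-1 : ℝ) ^ i) ≠ 0 := by positivity
  have e5 : poch (r - d) m * poch (-r - d) i = -(poch (r - d) i * poch (-r - d) m) :=
    mul_left_cancel₀ hs (by linear_combination e4)
  have hp (n : ℕ) : poch (-r - d) n ≠ 0 := poch_ne_zero fun k _ e =>
    hr (k - d) (by push_cast; linarith)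
  have e6 : poch (r - d) m / poch (-r - d) m = -(poch (r - d) i / poch (-r - d) i) := by
    rw [← neg_div, div_eq_div_iff (hp m) (hp i), e5]
    ring
  rw [hsub, kStarClosed, kStarClosed, e6, Nat.choose_symm_of_eq_add (by omega : 2 * d + 1 = m + i)]
  rw [show (2 * d - 2 * m + 1 : ℝ) = -(2 * d - 2 * i + 1) by linarith]
  ring

/-- One step in j on the left is two steps of the closed form on the right. The index 2j may exceed
d, where only the closed form is meaningful as a weight; `kStarClosed_symm` brings it back. -/
theorem racahWeight_eq {d j : ℕ} {r : ℝ} (hr : ∀ m : ℤ, r ≠ m) (hj : j ≤ d) :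
    racahWeight (-(d : ℝ) - 1) r ((r - d - 1) / 2) (-(r + d) / 2 - 1) j =
      kStarClosed d r (2 * j) := by
  induction j with
  | zero =>
    have : (2 * (d : ℝ) + 1) ≠ 0 := by positivity
    simp [racahWeight, kStarClosed, poch_zero, this]
  | succ j ih =>
    have ih' := ih (by omega)
    rw [racahWeight] at ih' ⊢
    simp only [poch_succ, Nat.factorial_succ]
    rw [show 2 * (j + 1) = 2 * j + 1 + 1 by ring, kStarClosed, cast_choose_succ (by omega),
      cast_choose_succ (by omega), poch_succ, poch_succ, poch_succ, poch_succ]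
    have hd0 : (2 * (d : ℝ) + 1) ≠ 0 := by positivity
    have hp : poch (-r - d) (2 * j) ≠ 0 := poch_ne_zero fun k _ e =>
      hr (k - d) (by push_cast; linarith)
    obtain ⟨N, hN⟩ : ∃ N, N = poch (-(d : ℝ) - 1 + 1) j * poch (r + (-(r + d) / 2 - 1) + 1) j
      * poch ((r - d - 1) / 2 + 1) j * poch ((r - d - 1) / 2 + (-(r + d) / 2 - 1) + 1) j
      * poch (((r - d - 1) / 2 + (-(r + d) / 2 - 1) + 3) / 2) j := ⟨_, rfl⟩
    obtain ⟨D, hD⟩ : ∃ D, D = poch (-(-(d : ℝ) - 1) + (r - d - 1) / 2 + (-(r + d) / 2 - 1) + 1) j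
      * poch (-r + (r - d - 1) / 2 + 1) j
      * poch (((r - d - 1) / 2 + (-(r + d) / 2 - 1) + 1) / 2) j
      * poch (-(r + d) / 2 - 1 + 1) j * (j.factorial : ℝ) := ⟨_, rfl⟩
    rw [← hN, ← hD, kStarClosed] at ih'
    obtain ⟨u, hu⟩ : ∃ u : ℝ, u = -r - d + 2 * j := ⟨_, rfl⟩
    obtain ⟨v, hv⟩ : ∃ v : ℝ, v = -r - d + 2 * j + 1 := ⟨_, rfl⟩
    obtain ⟨w, hw⟩ : ∃ w : ℝ, w = 4 * j - 2 * d - 1 := ⟨_, rfl⟩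
    have hu0 : u ≠ 0 := fun e => hr (2 * j - d) (by push_cast; linarith)
    have hv0 : v ≠ 0 := fun e => hr (2 * j - d + 1) (by push_cast; linarith)
    -- w is an odd integer.
    have hw0 : w ≠ 0 := by
      have : 4 * (j : ℤ) - 2 * d - 1 ≠ 0 := by omega
      rw [hw]
      exact_mod_cast this
    have hj0 : (j : ℝ) + 1 ≠ 0 := by positivity
    have hj1 : 2 * (j : ℝ) + 1 ≠ 0 := by positivity
    trans N / D * (((j - d) * (2 * j + r - d) * (2 * j + r - d + 1) * (2 * j - 2 * d - 1)
      * (4 * j - 2 * d + 3)) / ((2 * j + 1) * v * w * u * (j + 1)))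
    · rw [← mul_div_mul_comm]
      have a1 : (-(-(d : ℝ) - 1) + (r - d - 1) / 2 + (-(r + d) / 2 - 1) + 1 + j) =
        (2 * j + 1) / 2 := by ring
      have a2 : (-r + (r - d - 1) / 2 + 1 + j) = v / 2 := by rw [hv]; ring
      have a3 : (((r - d - 1) / 2 + (-(r + d) / 2 - 1) + 1) / 2 + j) = w / 4 := by rw [hw]; ring
      have a4 : (-(r + d) / 2 - 1 + 1 + j) = u / 2 := by rw [hu]; ring
      -- In numerator and denominator alike, the new factors carry three halves and one quarter,
      -- hence 1/32.
      rw [a1, a2, a3, a4, ← mul_div_mul_right (N * _) (D * _) (show (1 / 32 : ℝ) ≠ 0 by norm_num)]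
      congr 1
      · rw [hN]; ring
      · rw [hD]; push_cast; ring
    · rw [ih']
      have b1 : -r - d + ((2 * j : ℕ) : ℝ) = u := by rw [hu]; push_cast; ring
      have b2 : -r - d + ((2 * j + 1 : ℕ) : ℝ) = v := by rw [hv]; push_cast; ring
      have b3 : 2 * (d : ℝ) - 2 * ((2 * j : ℕ) : ℝ) + 1 = -w := by rw [hw]; push_cast; ring
      rw [b1, b2, b3]
      push_cast
      have hj2 : 2 * (j : ℝ) + 1 + 1 ≠ 0 := by positivity
      rw [show (2 * (j : ℝ) + 1 + 1) = 2 * (j + 1) by ring]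
      field_simp
      ring

/-- As |r| < 1, the factors r - d + k and -r - d + k with k < i ≤ d are all negative, so their
quotients are positive. -/
theorem kStarClosed_pos {d i : ℕ} {r : ℝ} (h1 : -1 < r) (h2 : r < 1) (hi : i ≤ d) :
    0 < kStarClosed d r i := by
  have hid : (i : ℝ) ≤ d := by exact_mod_cast hi
  have hq : 0 < poch (r - d) i / poch (-r - d) i := by
    rw [poch, poch, ← Finset.prod_div_distrib]
    refine Finset.prod_pos fun k hk => ?_
    have : (k : ℝ) + 1 ≤ d := by exact_mod_cast (Finset.mem_range.mp hk).trans_le hi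
    exact div_pos_of_neg_of_neg (by linarith) (by linarith)
  have hc : (0 : ℝ) < (2 * d + 1).choose i := by
    exact_mod_cast Nat.choose_pos (by omega)
  have : (0 : ℝ) < 2 * d - 2 * i + 1 := by linarith
  unfold kStarClosed
  positivity

/-! ### Identification of `uPoly` with the dual Hahn and Racah polynomials. -/

theorem quadPoch_eval_eq (c x : ℝ) (h : ℕ) :
    (quadPoch c h).eval x = ∏ k ∈ Finset.range h, ((k : ℝ) * (c + k) - x) := by
  simp [quadPoch, eval_prod]

theorem degree_quadPoch (c : ℝ) (h : ℕ) : (quadPoch c h).degree = h := by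
  have e : quadPoch c h = C ((-1) ^ h) * ∏ k ∈ Finset.range h, (X - C ((k : ℝ) * (c + k))) := by
    rw [quadPoch, C_pow, ← Finset.card_range h, ← Finset.prod_const, Finset.card_range,
      ← Finset.prod_mul_distrib]
    exact Finset.prod_congr rfl fun k _ => by simp
  rw [e, degree_C_mul (by positivity), degree_prod]
  simp only [degree_X_sub_C, Finset.sum_const, Finset.card_range, nsmul_eq_mul, mul_one]

theorem degree_sum_quadPoch (c : ℝ) (a : ℕ → ℝ) (n : ℕ) (ha : a n ≠ 0) :
    (∑ h ∈ Finset.range (n + 1), C (a h) * quadPoch c h).degree = n := by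
  have htop : (C (a n) * quadPoch c n).degree = n := by rw [degree_C_mul ha, degree_quadPoch]
  rw [Finset.sum_range_succ, degree_add_eq_right_of_degree_lt, htop]
  rw [htop]
  rw [← mem_degreeLT]
  refine Submodule.sum_mem _ fun h hh => mem_degreeLT.mpr ?_
  rw [← smul_eq_C_mul]
  refine (degree_smul_le _ _).trans_lt ?_
  rw [degree_quadPoch]
  exact_mod_cast Finset.mem_range.mp hh

/-- Padding with zero coefficients gives all indices n ≤ d the same summation range, as the
recurrences require. -/
theorem sum_quadPoch_eval (c : ℝ) (a node : ℕ → ℝ) {n d : ℕ} (hn : n ≤ d)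
    (ha : ∀ h, n < h → a h = 0) (hnode : ∀ k : ℕ, (k : ℝ) * (c + k) = node k) (x : ℝ) :
    (∑ h ∈ Finset.range (n + 1), C (a h) * quadPoch c h).eval x = newtonSum d node a x := by
  rw [eval_finsetSum, newtonSum]
  simp only [eval_mul, eval_C, quadPoch_eval_eq, hnode]
  refine Finset.sum_subset (Finset.range_subset_range.mpr (by omega)) fun h _ hh => ?_
  rw [ha h (by simpa [Nat.lt_succ_iff] using hh), zero_mul]

/-- The parameter `-(-r) - d - 1` is -s - d - 1 after the substitution s = -r, kept in this shape to
match the main statement. -/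
theorem dualHahnPoly_eq (d : ℕ) (r : ℝ) (n : ℕ) :
    dualHahnPoly (-(-r) - d - 1) (-r - d - 1) d n =
      ∑ h ∈ Finset.range (n + 1), C (dhCoeff d r n h) * quadPoch (-2 * d - 1) h := by
  have e1 : -(-r) - d - 1 + 1 = r - d := by ring
  have e2 : -(-r) - d - 1 + (-r - d - 1) + 1 = -2 * (d : ℝ) - 1 := by ring
  simp only [dualHahnPoly, dhCoeff, e1, e2]

theorem dualHahnPoly_eval_eq (d : ℕ) (r : ℝ) {n : ℕ} (hn : n ≤ d) (x : ℝ) :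
    (dualHahnPoly (-(-r) - d - 1) (-r - d - 1) d n).eval x =
      newtonSum d (dhNode d) (dhCoeff d r n) x := by
  rw [dualHahnPoly_eq]
  exact sum_quadPoch_eval _ _ _ hn (fun h hh => dhCoeff_eq_zero d r hh)
    (fun k => by rw [dhNode]; ring) x

theorem degree_dualHahnPoly {d : ℕ} {r : ℝ} (hr : ∀ m : ℤ, r ≠ m) {n : ℕ} (hn : n ≤ d) :
    (dualHahnPoly (-(-r) - d - 1) (-r - d - 1) d n).degree = n := by
  rw [dualHahnPoly_eq]
  refine degree_sum_quadPoch _ _ _ (div_ne_zero (poch_neg_ne_zero le_rfl) ?_)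
  refine mul_ne_zero (mul_ne_zero (poch_ne_zero fun k _ e => hr (d - k) ?_)
    (poch_neg_ne_zero hn)) (by positivity)
  push_cast
  linarith

theorem racahPoly_eval_eq (d : ℕ) (r : ℝ) {n : ℕ} (hn : n ≤ d) (x : ℝ) :
    (racahPoly (-(d : ℝ) - 1) r ((r - d - 1) / 2) (-(r + d) / 2 - 1) n).eval x =
      newtonSum d (raNode d) (raCoeff d r n) x := by
  have e1 : -(d : ℝ) - 1 + 1 = -d := by ring
  have e2 : r + (-(r + d) / 2 - 1) + 1 = (r - d) / 2 := by ring
  have e3 : (r - d - 1) / 2 + 1 = (r - d + 1) / 2 := by ring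
  have e4 : n + (-(d : ℝ) - 1) + r + 1 = n + r - d := by ring
  rw [racahPoly, e1, e2, e3, e4]
  exact sum_quadPoch_eval _ (raCoeff d r n) _ hn (fun h hh => raCoeff_eq_zero d r hh)
    (fun k => by rw [raNode]; ring) x

theorem theta_eq_dhNode (d : ℕ) (r : ℝ) (j : ℕ) :
    theta d r (-r) j = dhNode d j + d * (d + 1) := by
  rw [theta, dhNode]; ring

theorem uPoly_eq {d : ℕ} {r : ℝ} (h1 : -1 < r) (h2 : r < 1) (hr : ∀ m : ℤ, r ≠ m) {i : ℕ}
    (hi : i ≤ d) :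
    uPoly d r (-r) i = (dualHahnPoly (-(-r) - d - 1) (-r - d - 1) d i).comp
      (X - C ((d : ℝ) * (d + 1))) := by
  symm
  rw [uPoly_unique d h1 (by linarith)]
  constructor
  · have hdeg := natDegree_eq_of_degree_eq_some (degree_dualHahnPoly hr hi)
    refine degree_le_of_natDegree_le ?_
    rw [natDegree_comp, natDegree_X_sub_C, mul_one, hdeg]
    exact hi
  · intro j _
    have e := dualHahnPoly_eval (-(-r) - d - 1) (-r - d - 1) d i j
    have hl : (theta d r (-r) j) - d * (d + 1) =
        (j : ℝ) * (j + (-(-r) - d - 1) + (-r - d - 1) + 1) := by rw [theta]; ring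
    simp only [eval_comp, eval_sub, eval_X, eval_C]
    have e1 : (j : ℝ) + (-(-r) - d - 1) + (-r - d - 1) + 1 = j - r - -r - 2 * d - 1 := by ring
    have e2 : -(-r) - (d : ℝ) - 1 + 1 = -(-r) - d := by ring
    rw [hl, e, e1, e2]

theorem uPoly_eval {d : ℕ} {r : ℝ} (h1 : -1 < r) (h2 : r < 1) (hr : ∀ m : ℤ, r ≠ m) {i : ℕ}
    (hi : i ≤ d) (x : ℝ) :
    (uPoly d r (-r) i).eval (x + d * (d + 1)) = newtonSum d (dhNode d) (dhCoeff d r i) x := by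
  rw [uPoly_eq h1 h2 hr hi, eval_comp, ← dualHahnPoly_eval_eq d r hi]
  simp

theorem uPoly_comp_eq_dualHahnPoly {d : ℕ} {r : ℝ} (h1 : -1 < r) (h2 : r < 1)
    (hr : ∀ m : ℤ, r ≠ m) {i : ℕ} (hi : i ≤ d) :
    (uPoly d r (-r) i).comp (X + C ((d : ℝ) * (d + r + -r + 1))) =
      dualHahnPoly (-(-r) - d - 1) (-r - d - 1) d i := by
  have e : (d : ℝ) + r + -r + 1 = d + 1 := by ring
  refine Polynomial.funext fun x => ?_
  rw [e, eval_comp, dualHahnPoly_eval_eq d r hi, ← uPoly_eval h1 h2 hr hi]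
  simp

theorem degree_uPoly {d : ℕ} {r : ℝ} (h1 : -1 < r) (h2 : r < 1) (hr : ∀ m : ℤ, r ≠ m) {i : ℕ}
    (hi : i ≤ d) : (uPoly d r (-r) i).degree = i := by
  have hdeg := degree_dualHahnPoly hr hi
  have hnat := natDegree_eq_of_degree_eq_some hdeg
  have hne : uPoly d r (-r) i ≠ 0 := fun h0 => by
    rw [← uPoly_comp_eq_dualHahnPoly h1 h2 hr hi, h0, zero_comp, degree_zero] at hdeg
    exact WithBot.bot_ne_coe hdeg
  rw [degree_eq_natDegree hne, uPoly_eq h1 h2 hr hi, natDegree_comp, natDegree_X_sub_C, mul_one,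
    hnat]

theorem uPoly_comp_eq_racahPoly {d : ℕ} {r : ℝ} (h1 : -1 < r) (h2 : r < 1)
    (hr : ∀ m : ℤ, r ≠ m) {i : ℕ} (hi : i ≤ d) :
    (uPoly d r (-r) i).comp (4 * X + C ((d : ℝ) * (d + 1))) =
      racahPoly (-(d : ℝ) - 1) r ((r - d - 1) / 2) (-(r + d) / 2 - 1) i := by
  refine Polynomial.funext fun x => ?_
  rw [racahPoly_eval_eq d r hi, ← dh_eq_ra d hr hi, ← uPoly_eval h1 h2 hr hi, eval_comp]
  simp

theorem four_mul_racahLattice (d : ℕ) (r : ℝ) (j : ℕ) :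
    4 * racahLattice ((r - d - 1) / 2) (-(r + d) / 2 - 1) (j : ℝ) + (d : ℝ) * (d + 1) =
      thetaBar d j := by
  rw [racahLattice, thetaBar]; ring

theorem uPoly_eval_thetaBar {d : ℕ} {r : ℝ} (h1 : -1 < r) (h2 : r < 1)
    (hr : ∀ m : ℤ, r ≠ m) {i : ℕ} (hi : i ≤ d) (j : ℕ) :
    (uPoly d r (-r) i).eval (thetaBar d j) =
      hypergeom [-(i : ℝ), i - d + r, -(j : ℝ), j - d - 1 / 2]
        [-(d : ℝ), (r - d) / 2, (r - d + 1) / 2] 1 := by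
  have e := racahPoly_eval (-(d : ℝ) - 1) r ((r - d - 1) / 2) (-(r + d) / 2 - 1) i j
  have e1 : -(d : ℝ) - 1 + 1 = -d := by ring
  have e2 : r + (-(r + d) / 2 - 1) + 1 = (r - d) / 2 := by ring
  have e3 : (r - d - 1) / 2 + 1 = (r - d + 1) / 2 := by ring
  have e4 : i + (-(d : ℝ) - 1) + r + 1 = i - d + r := by ring
  have e5 : j + (r - d - 1) / 2 + (-(r + d) / 2 - 1) + 1 = (j : ℝ) - d - 1 / 2 := by ring
  rw [e1, e2, e3, e4, e5, ← uPoly_comp_eq_racahPoly h1 h2 hr hi, eval_comp] at e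
  rw [← four_mul_racahLattice d r, ← e]
  simp

/-! ### The permutation of points and weights. -/

/-- The permutation `j ↦ 2 j` or `2 d + 1 - 2 j` of `{0, …, d}`. -/
theorem exists_perm (d : ℕ) : ∃ σ : Equiv.Perm (Fin (d + 1)), ∀ j : Fin (d + 1),
    (σ j : ℕ) = 2 * j ∨ (2 * (j : ℕ) ≤ 2 * d + 1 ∧ (σ j : ℕ) = 2 * d + 1 - 2 * j) := by
  let f : Fin (d + 1) → Fin (d + 1) := fun j =>
    if h : 2 * (j : ℕ) ≤ d then ⟨2 * j, by omega⟩ else ⟨2 * d + 1 - 2 * j, by omega⟩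
  -- The first branch takes even values and the second odd ones, so the branches cannot collide.
  have hf : Function.Injective f := by
    intro a b hab
    have := a.2
    have := b.2
    simp only [f] at hab
    split_ifs at hab <;> simp only [Fin.mk.injEq] at hab <;> exact Fin.ext (by omega)
  refine ⟨Equiv.ofBijective f (Finite.injective_iff_bijective.mp hf), fun j => ?_⟩
  have := j.2
  simp only [Equiv.ofBijective_apply, f]
  split_ifs
  · exact Or.inl rfl
  · exact Or.inr ⟨by omega, rfl⟩

/-- Points and closed-form weights are both invariant under i ↦ 2d+1-i, so either value of σ j may
be replaced by the formal index 2j. -/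
theorem exists_perm_points_weights (d : ℕ) {r : ℝ} (hr : ∀ m : ℤ, r ≠ m) :
    ∃ σ : Equiv.Perm (Fin (d + 1)), ∀ j : Fin (d + 1),
      4 * racahLattice ((r - d - 1) / 2) (-(r + d) / 2 - 1) ((j : ℕ) : ℝ) + (d : ℝ) * (d + 1) =
          thetaBar d j ∧
      thetaBar d j = theta d r (-r) (σ j) ∧
      racahWeight (-(d : ℝ) - 1) r ((r - d - 1) / 2) (-(r + d) / 2 - 1) j =
          kStar d r (-r) (σ j) := by
  obtain ⟨σ, hσ⟩ := exists_perm d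
  refine ⟨σ, fun j => ⟨four_mul_racahLattice d r j, ?_, ?_⟩⟩
  · rw [theta, thetaBar]
    rcases hσ j with h | ⟨hle, h⟩
    · rw [h]; push_cast; ring
    · rw [h, Nat.cast_sub hle]; push_cast; ring
  · rw [racahWeight_eq hr (Nat.lt_succ_iff.mp j.2), kStar_eq hr (Nat.lt_succ_iff.mp (σ j).2)]
    rcases hσ j with h | ⟨hle, h⟩
    · rw [h]
    · rw [h, kStarClosed_symm hr hle]

/-! ### Chu–Vandermonde and special values at the nodes. -/

theorem poch_one (n : ℕ) : poch 1 n = n.factorial := by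
  rw [← Finset.prod_range_add_one_eq_factorial, poch]
  push_cast
  exact Finset.prod_congr rfl fun k _ => add_comm _ _

theorem poch_neg_self (n : ℕ) : poch (-(n : ℝ)) n = (-1) ^ n * n.factorial := by
  have := poch_reverse 1 n
  rwa [poch_one, sub_self, zero_sub] at this

/-- The Chu–Vandermonde sum. -/
theorem chu_vandermonde (n M : ℕ) (hM : n ≤ M) (b c : ℝ) (hc : ∀ k : ℕ, c + k ≠ 0) :
    ∑ m ∈ Finset.range (M + 1), poch (-(n : ℝ)) m * poch b m / (poch c m * m.factorial) =
      poch (c - b) n / poch c n := by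
  induction n generalizing M b c with
  | zero =>
    rw [Finset.sum_eq_single 0]
    · simp [poch_zero]
    · intro m _ hm
      rw [poch_neg_eq_zero (Nat.pos_of_ne_zero hm)]
      simp
    · simp
  | succ n ih =>
    obtain ⟨M, rfl⟩ : ∃ N, M = N + 1 := ⟨M - 1, by omega⟩
    have hc' (k : ℕ) : c + 1 + k ≠ 0 := by
      have := hc (k + 1)
      push_cast at this
      rwa [add_assoc, add_comm 1]
    have hc0 : c ≠ 0 := by simpa using hc 0
    have i1 := ih (M + 1) (by omega) b c hc
    have i2 := ih M (by omega) (b + 1) (c + 1) hc'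
    have hp (n : ℕ) : poch c n ≠ 0 := poch_ne_zero fun k _ => hc k
    have hp' (n : ℕ) : poch (c + 1) n ≠ 0 := poch_ne_zero fun k _ => hc' k
    -- Termwise form of F(n+1; b, c) = F(n; b, c) - (b/c) F(n; b+1, c+1), which is why b and c vary
    -- in the induction.
    have hterm (m : ℕ) : poch (-((n + 1 : ℕ) : ℝ)) (m + 1) * poch b (m + 1) /
        (poch c (m + 1) * (m + 1).factorial) = poch (-(n : ℝ)) (m + 1) * poch b (m + 1) /
        (poch c (m + 1) * (m + 1).factorial) - b / c * (poch (-(n : ℝ)) m * poch (b + 1) m /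
        (poch (c + 1) m * m.factorial)) := by
      have e1 : poch (-((n + 1 : ℕ) : ℝ)) (m + 1) = -((n : ℝ) + 1) * poch (-(n : ℝ)) m := by
        rw [poch_succ_left]; push_cast; congr 2; ring
      rw [e1, poch_succ (-(n : ℝ)) m, poch_succ_left b, poch_succ_left c, Nat.factorial_succ]
      have h1 := hp' m
      have h2 : (m.factorial : ℝ) ≠ 0 := by positivity
      have h3 : (m : ℝ) + 1 ≠ 0 := by positivity
      push_cast
      field_simp
      ring
    rw [Finset.sum_range_succ'] at i1 ⊢
    simp only [hterm]
    rw [Finset.sum_sub_distrib, ← Finset.mul_sum, i2]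
    have e2 : c + 1 - (b + 1) = c - b := by ring
    have e3 : poch c (n + 1) = c * poch (c + 1) n := poch_succ_left c n
    have e4 := poch_succ c n
    have e5 : poch (c + 1) n = poch c n * (c + n) / c := by
      rw [eq_div_iff hc0, ← e4, e3, mul_comm]
    simp only [poch_zero] at i1 ⊢
    rw [e2, e4, e5, poch_succ]
    have h1 := hp n
    have h2 := hc n
    have : poch (c - b) n * (c - b + n) / (poch c n * (c + n)) =
        poch (c - b) n / poch c n - b / c * (poch (c - b) n / (poch c n * (c + n) / c)) := by
      field_simp
      ring
    rw [this]
    linear_combination i1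

/-- The value of the last dual Hahn polynomial at the nodes. -/
theorem newtonSum_top_eval {d : ℕ} {r : ℝ} (hr : ∀ m : ℤ, r ≠ m) {h : ℕ} (hh : h ≤ d) :
    newtonSum d (dhNode d) (dhCoeff d r d) (dhNode d h) =
      (-1) ^ h * poch (-r - d) h / poch (r - d) h := by
  have hc (k : ℕ) : r - d + k ≠ 0 := fun e => hr (d - k) (by push_cast; linarith)
  -- At top index d the factor (-d)_m cancels, so the ₃F₂ collapses to ₂F₁(-h, h-2d-1; r-d | 1).
  have e := chu_vandermonde h d hh (h - 2 * d - 1) (r - d) hc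
  rw [← poch_reverse]
  rw [show 1 - (-r - d) - h = r - d - (h - 2 * d - 1) by ring, ← e, newtonSum]
  refine Finset.sum_congr rfl fun m hm => ?_
  have hp : poch (-(d : ℝ)) m ≠ 0 :=
    poch_neg_ne_zero (Nat.lt_succ_iff.mp (Finset.mem_range.mp hm))
  have : ∏ k ∈ Finset.range m, (dhNode d k - dhNode d h) =
      poch (-(h : ℝ)) m * poch (h - 2 * d - 1) m := by
    rw [poch, poch, ← Finset.prod_mul_distrib]
    refine Finset.prod_congr rfl fun k _ => ?_
    rw [dhNode, dhNode]
    ring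
  have hp' : poch (r - d) m ≠ 0 := poch_ne_zero fun k _ => hc k
  have hf : (m.factorial : ℝ) ≠ 0 := by positivity
  rw [this, dhCoeff]
  field_simp

/-- The product of the differences between one node and all the others. -/
theorem prod_dhNode_sub {d h : ℕ} (hh : h ≤ d) :
    (∏ k ∈ (Finset.range (d + 1)).erase h, (dhNode d k - dhNode d h)) * (2 * d - 2 * h + 1) =
      (-1) ^ (d + h) * (h.factorial * (2 * d + 1 - h).factorial) := by
  obtain ⟨e, rfl⟩ := Nat.exists_eq_add_of_le hh
  have hset : (Finset.range (h + e + 1)).erase h =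
      Finset.range h ∪ (Finset.range e).image (h + 1 + ·) := by
    ext k
    simp only [Finset.mem_erase, Finset.mem_range, Finset.mem_union, Finset.mem_image]
    constructor
    · rintro ⟨h1, h2⟩
      rcases lt_or_ge k h with hk | hk
      · exact Or.inl hk
      · exact Or.inr ⟨k - (h + 1), by omega, by omega⟩
    · rintro (h1 | ⟨a, h1, rfl⟩) <;> omega
  have hdisj : Disjoint (Finset.range h) ((Finset.range e).image (h + 1 + ·)) := by
    rw [Finset.disjoint_left]
    intro k hk hk'
    obtain ⟨a, _, rfl⟩ := Finset.mem_image.mp hk'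
    have := Finset.mem_range.mp hk
    omega
  -- Each difference is (h - k)(2d + 1 - h - k). With d = h + e, the nodes below h give h! (h+2e+1)!
  -- / (2e+1)! and those above give (-1)^e (2e)!. The factor 2d - 2h + 1 = 2e + 1 closes the gap
  -- between the factorials.
  rw [hset, Finset.prod_union hdisj, Finset.prod_image fun a _ b _ hab => by simpa using hab]
  have f1 (m n : ℕ) (hmn : n ≤ m) :
      (∏ k ∈ Finset.range n, ((m : ℝ) - k)) * (m - n).factorial = m.factorial := by
    rw [← Nat.factorial_mul_descFactorial hmn, Nat.descFactorial_eq_prod_range, mul_comm]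
    push_cast
    congr 1
    refine Finset.prod_congr rfl fun k hk => ?_
    rw [Nat.cast_sub ((Finset.mem_range.mp hk).le.trans hmn)]
  have p1 : ∏ k ∈ Finset.range h, (dhNode (h + e) k - dhNode (h + e) h) =
      (∏ k ∈ Finset.range h, ((h : ℝ) - k)) *
        ∏ k ∈ Finset.range h, (((h + 2 * e + 1 : ℕ) : ℝ) - k) := by
    rw [← Finset.prod_mul_distrib]
    refine Finset.prod_congr rfl fun k _ => ?_
    rw [dhNode, dhNode]
    push_cast
    ring
  have p2 : ∏ k ∈ Finset.range e, (dhNode (h + e) (h + 1 + k) - dhNode (h + e) h) =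
      (-1) ^ e * poch 1 e * ∏ k ∈ Finset.range e, (((2 * e : ℕ) : ℝ) - k) := by
    have : (-1 : ℝ) ^ e = ∏ _k ∈ Finset.range e, (-1) := by simp
    rw [this, poch, ← Finset.prod_mul_distrib, ← Finset.prod_mul_distrib]
    refine Finset.prod_congr rfl fun k _ => ?_
    rw [dhNode, dhNode]
    push_cast
    ring
  have g1 := f1 h h le_rfl
  have g2 := f1 (h + 2 * e + 1) h (by omega)
  have g3 := f1 (2 * e) e (by omega)
  rw [Nat.sub_self, Nat.factorial_zero, Nat.cast_one, mul_one] at g1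
  rw [show h + 2 * e + 1 - h = 2 * e + 1 by omega, Nat.factorial_succ] at g2
  rw [show 2 * e - e = e by omega] at g3
  rw [p1, p2, g1, poch_one, show 2 * (h + e) + 1 - h = h + 2 * e + 1 by omega, ← g2,
    show h + e + h = e + 2 * h by ring, pow_add, pow_mul]
  push_cast at g3 ⊢
  rw [← g3]
  norm_num
  ring

/-! ### Orthogonality summed over the index. -/

theorem bCoeff_pos {d i : ℕ} {r : ℝ} (h2 : r < 1) (hi : i < d) : 0 < bCoeff d (-r) i := by
  have : (i : ℝ) + 1 ≤ d := by exact_mod_cast hi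
  exact mul_pos (by linarith) (by linarith)

theorem cCoeff_pos {i : ℕ} {r : ℝ} (h1 : -1 < r) (hi : 1 ≤ i) : 0 < cCoeff r i := by
  have : (1 : ℝ) ≤ i := by exact_mod_cast hi
  exact mul_pos (by linarith) (by linarith)

theorem prod_cCoeff_pos (i : ℕ) {r : ℝ} (h1 : -1 < r) :
    0 < ∏ h ∈ Finset.Icc 1 i, cCoeff r h :=
  Finset.prod_pos fun _ hh => cCoeff_pos h1 (Finset.mem_Icc.mp hh).1

theorem kCoeff_pos {d i : ℕ} {r : ℝ} (h1 : -1 < r) (h2 : r < 1) (hi : i ≤ d) :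
    0 < kCoeff d r (-r) i :=
  div_pos (Finset.prod_pos fun _ hh => bCoeff_pos h2 ((Finset.mem_range.mp hh).trans_le hi))
    (prod_cCoeff_pos i h1)

theorem kCoeff_succ (d i : ℕ) {r : ℝ} (h1 : -1 < r) :
    kCoeff d r (-r) (i + 1) * cCoeff r (i + 1) = kCoeff d r (-r) i * bCoeff d (-r) i := by
  have h := (prod_cCoeff_pos i h1).ne'
  have h' := (cCoeff_pos (i := i + 1) h1 (by omega)).ne'
  rw [kCoeff, kCoeff, Finset.prod_range_succ, Finset.prod_Icc_succ_top (by omega)]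
  field_simp

/-- The product b_0 ⋯ b_{d-1} equals (r-d)_d (-d)_d, exactly the Pochhammer denominators of the top
coefficient. -/
theorem kCoeff_mul_dhCoeff {d : ℕ} {r : ℝ} (hr : ∀ m : ℤ, r ≠ m) :
    kCoeff d r (-r) d * dhCoeff d r d d = (-1) ^ d / ∏ h ∈ Finset.Icc 1 d, cCoeff r h := by
  have hb : ∏ h ∈ Finset.range d, bCoeff d (-r) h = poch (r - d) d * poch (-(d : ℝ)) d := by
    rw [poch, poch, ← Finset.prod_mul_distrib]
    refine Finset.prod_congr rfl fun k _ => ?_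
    rw [bCoeff]
    ring
  have h1 : poch (r - d) d ≠ 0 := poch_ne_zero fun k _ e => hr (d - k) (by push_cast; linarith)
  have h2 : poch (-(d : ℝ)) d ≠ 0 := poch_neg_ne_zero le_rfl
  have h3 : (d.factorial : ℝ) ≠ 0 := by positivity
  rw [kCoeff, hb, dhCoeff, div_mul_div_comm, mul_comm (∏ h ∈ Finset.Icc 1 d, cCoeff r h),
    ← div_div]
  congr 1
  rw [div_eq_iff (by positivity), poch_neg_self]
  ring

/-- The Christoffel–Darboux formula. -/
theorem christoffel_darboux (m : ℕ) (k b c f g f' g' : ℕ → ℝ) (x y : ℝ) (hc : c 0 = 0)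
    (hk : ∀ n < m, k (n + 1) * c (n + 1) = k n * b n)
    (hf' : ∀ n, f' (n + 1) = f n) (hg' : ∀ n, g' (n + 1) = g n)
    (hf : ∀ n < m, b n * (f (n + 1) - f n) - c n * (f n - f' n) = x * f n)
    (hg : ∀ n < m, b n * (g (n + 1) - g n) - c n * (g n - g' n) = y * g n) :
    (x - y) * ∑ n ∈ Finset.range m, k n * f n * g n =
      k m * c m * (f m * g' m - f' m * g m) := by
  induction m with
  | zero => simp [hc]
  | succ m ih =>
    have i := ih (fun n hn => hk n (by omega)) (fun n hn => hf n (by omega))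
      (fun n hn => hg n (by omega))
    have h1 := hf m (by omega)
    have h2 := hg m (by omega)
    rw [Finset.sum_range_succ, mul_add, i, hf', hg', hk m (by omega)]
    linear_combination (-(k m * g m)) * h1 + (k m * f m) * h2

theorem sum_kCoeff_newtonSum {d : ℕ} {r : ℝ} (h1 : -1 < r) (hr : ∀ m : ℤ, r ≠ m) {h : ℕ}
    (hh : h ≤ d) (x : ℝ) :
    (x - dhNode d h) * ∑ n ∈ Finset.range (d + 1), kCoeff d r (-r) n *
        newtonSum d (dhNode d) (dhCoeff d r n) x *
        newtonSum d (dhNode d) (dhCoeff d r n) (dhNode d h) =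
      -(kCoeff d r (-r) d * dhCoeff d r d d *
        newtonSum d (dhNode d) (dhCoeff d r d) (dhNode d h) *
        ∏ k ∈ Finset.range (d + 1), (dhNode d k - x)) := by
  have hrec (z : ℝ) (n : ℕ) (hn : n < d) : bCoeff d (-r) n *
      (newtonSum d (dhNode d) (dhCoeff d r ((n + 1 : ℕ) : ℝ)) z
        - newtonSum d (dhNode d) (dhCoeff d r n) z)
      - cCoeff r n * (newtonSum d (dhNode d) (dhCoeff d r n) z
        - newtonSum d (dhNode d) (dhCoeff d r (n - 1)) z) =
      z * newtonSum d (dhNode d) (dhCoeff d r n) z := by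
    have e := dh_recurrence d hr n z
    rw [dhCoeff_eq_zero d r hn, zero_mul] at e
    rw [bCoeff, cCoeff]
    push_cast
    linear_combination e
  have hpred (z : ℝ) (n : ℕ) : newtonSum d (dhNode d) (dhCoeff d r (((n + 1 : ℕ) : ℝ) - 1)) z =
      newtonSum d (dhNode d) (dhCoeff d r n) z := by
    rw [Nat.cast_succ, add_sub_cancel_right]
  have e := christoffel_darboux d (kCoeff d r (-r)) (bCoeff d (-r)) (fun n => cCoeff r n)
    (fun n => newtonSum d (dhNode d) (dhCoeff d r n) x)
    (fun n => newtonSum d (dhNode d) (dhCoeff d r n) (dhNode d h))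
    (fun n => newtonSum d (dhNode d) (dhCoeff d r (n - 1)) x)
    (fun n => newtonSum d (dhNode d) (dhCoeff d r (n - 1)) (dhNode d h)) x (dhNode d h)
    (by simp [cCoeff]) (fun n _ => kCoeff_succ d n h1) (hpred x) (hpred _) (hrec x) (hrec _)
  -- At t = d the leading coefficient d - t vanishes, so the recurrence expresses c_d(u_d - u_{d-1})
  -- without u_{d+1}, at the price of the node product. At the node λ_h this product is zero.
  have t1 := dh_recurrence d hr d x
  have t2 := dh_recurrence d hr d (dhNode d h)
  rw [Finset.prod_eq_zero (Finset.mem_range.mpr (Nat.lt_succ_of_le hh)) (sub_self _)] at t2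
  rw [Finset.sum_range_succ, mul_add, e, cCoeff]
  linear_combination -(kCoeff d r (-r) d *
      newtonSum d (dhNode d) (dhCoeff d r d) (dhNode d h)) * t1 +
    (kCoeff d r (-r) d * newtonSum d (dhNode d) (dhCoeff d r d) x) * t2

/-- The factor x - λ_h cannot be divided out at x = λ_h, the value needed for the diagonal. It is
cancelled in ℝ[X] instead. -/
theorem sum_kCoeff_newtonSum_eq {d : ℕ} {r : ℝ} (h1 : -1 < r) (hr : ∀ m : ℤ, r ≠ m) {h : ℕ}
    (hh : h ≤ d) (x : ℝ) :
    ∑ n ∈ Finset.range (d + 1), kCoeff d r (-r) n *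
        newtonSum d (dhNode d) (dhCoeff d r n) x *
        newtonSum d (dhNode d) (dhCoeff d r n) (dhNode d h) =
      kCoeff d r (-r) d * dhCoeff d r d d *
        newtonSum d (dhNode d) (dhCoeff d r d) (dhNode d h) *
        ∏ k ∈ (Finset.range (d + 1)).erase h, (dhNode d k - x) := by
  let P : ℝ[X] := ∑ n ∈ Finset.range (d + 1),
    C (kCoeff d r (-r) n) * dualHahnPoly (-(-r) - d - 1) (-r - d - 1) d n *
      C (newtonSum d (dhNode d) (dhCoeff d r n) (dhNode d h))
  let Q : ℝ[X] := C (kCoeff d r (-r) d * dhCoeff d r d d *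
    newtonSum d (dhNode d) (dhCoeff d r d) (dhNode d h)) *
      ∏ k ∈ (Finset.range (d + 1)).erase h, (C (dhNode d k) - X)
  have hP (y : ℝ) : P.eval y = ∑ n ∈ Finset.range (d + 1), kCoeff d r (-r) n *
        newtonSum d (dhNode d) (dhCoeff d r n) y *
        newtonSum d (dhNode d) (dhCoeff d r n) (dhNode d h) := by
    simp only [P, eval_finsetSum, eval_mul, eval_C]
    refine Finset.sum_congr rfl fun n hn => ?_
    rw [dualHahnPoly_eval_eq d r (Nat.lt_succ_iff.mp (Finset.mem_range.mp hn))]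
  have hQ (y : ℝ) : Q.eval y = kCoeff d r (-r) d * dhCoeff d r d d *
        newtonSum d (dhNode d) (dhCoeff d r d) (dhNode d h) *
        ∏ k ∈ (Finset.range (d + 1)).erase h, (dhNode d k - y) := by
    simp only [Q, eval_mul, eval_C, eval_prod, eval_sub, eval_X]
  rw [← hP, ← hQ]
  congr 1
  refine mul_left_cancel₀ (X_sub_C_ne_zero (dhNode d h)) (Polynomial.funext fun y => ?_)
  rw [eval_mul, eval_mul, hP, hQ, eval_sub, eval_X, eval_C, sum_kCoeff_newtonSum h1 hr hh,
    ← Finset.mul_prod_erase _ _ (Finset.mem_range.mpr (Nat.lt_succ_of_le hh))]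
  ring

theorem nu_eq {d : ℕ} {r : ℝ} :
    nu d r (-r) = (2 * d).factorial / ∏ h ∈ Finset.Icc 1 d, cCoeff r h := by
  rw [nu]
  congr 1
  have e := prod_dhNode_sub (Nat.zero_le d)
  have hset : (Finset.range (d + 1)).erase 0 = Finset.Icc 1 d := by
    ext k
    simp only [Finset.mem_erase, Finset.mem_range, Finset.mem_Icc]
    omega
  have hneg : ∏ k ∈ Finset.Icc 1 d, (theta d r (-r) 0 - theta d r (-r) k) =
      (-1) ^ d * ∏ k ∈ Finset.Icc 1 d, (dhNode d k - dhNode d 0) := by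
    have : (-1 : ℝ) ^ d = ∏ _k ∈ Finset.Icc 1 d, (-1) := by simp
    rw [this, ← Finset.prod_mul_distrib]
    refine Finset.prod_congr rfl fun k _ => ?_
    rw [theta_eq_dhNode, theta_eq_dhNode]
    ring
  have hd : (2 * (d : ℝ) + 1) ≠ 0 := by positivity
  rw [hset, Nat.sub_zero, Nat.factorial_succ] at e
  have hs : ((-1 : ℝ) ^ d) * (-1) ^ d = 1 := by rw [← mul_pow]; norm_num
  rw [hneg]
  refine mul_right_cancel₀ hd ?_
  push_cast [Nat.factorial_zero] at e
  simp only [add_zero, mul_zero, sub_zero, one_mul] at e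
  rw [mul_assoc, e]
  linear_combination ((2 * d).factorial * (2 * (d : ℝ) + 1)) * hs

/-- The orthogonality relation of the values at the nodes, summed over the index. -/
theorem sum_kCoeff_mul_kStarClosed {d : ℕ} {r : ℝ} (h1 : -1 < r) (hr : ∀ m : ℤ, r ≠ m) {g h : ℕ}
    (hg : g ≤ d) (hh : h ≤ d) :
    (∑ n ∈ Finset.range (d + 1), kCoeff d r (-r) n *
        newtonSum d (dhNode d) (dhCoeff d r n) (dhNode d g) *
        newtonSum d (dhNode d) (dhCoeff d r n) (dhNode d h)) * kStarClosed d r h =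
      if g = h then nu d r (-r) else 0 := by
  rw [sum_kCoeff_newtonSum_eq h1 hr hh]
  split_ifs with hgh
  · subst hgh
    have e := prod_dhNode_sub hg
    have hgd : (g : ℝ) ≤ d := by exact_mod_cast hg
    have hv : (2 * (d : ℝ) - 2 * g + 1) ≠ 0 := by linarith
    have hd : (2 * (d : ℝ) + 1) ≠ 0 := by positivity
    have hp : poch (-r - d) g ≠ 0 := poch_ne_zero fun k _ e =>
      hr (k - d) (by push_cast; linarith)
    have hp' : poch (r - d) g ≠ 0 := poch_ne_zero fun k _ e =>
      hr (d - k) (by push_cast; linarith)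
    have hC := (prod_cCoeff_pos d h1).ne'
    have hch : ((2 * d + 1).choose g : ℝ) * (g.factorial * (2 * d + 1 - g).factorial) =
        (2 * d + 1) * (2 * d).factorial := by
      have := Nat.choose_mul_factorial_mul_factorial (show g ≤ 2 * d + 1 by omega)
      rw [Nat.factorial_succ] at this
      rw [← mul_assoc]
      exact_mod_cast this
    have hs : ((-1 : ℝ) ^ d) * (-1) ^ g * (-1) ^ (d + g) = 1 := by
      rw [← pow_add, ← mul_pow]; norm_num
    rw [kCoeff_mul_dhCoeff hr, newtonSum_top_eval hr hg, nu_eq, kStarClosed, div_mul_eq_mul_div,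
      div_mul_eq_mul_div, div_mul_eq_mul_div]
    congr 1
    -- The Pochhammer quotient of the weight cancels the top value at the node, leaving signs,
    -- factorials and a binomial coefficient.
    trans ((-1) ^ d * (-1) ^ g) * ((∏ k ∈ (Finset.range (d + 1)).erase g,
      (dhNode d k - dhNode d g)) * (2 * d - 2 * g + 1)) * ((2 * d + 1).choose g) / (2 * d + 1)
    · field_simp
    · rw [e, div_eq_iff hd]
      linear_combination ((2 * d + 1).choose g * (g.factorial * (2 * d + 1 - g).factorial) : ℝ) * hs
        + hch
  · rw [Finset.prod_eq_zero (Finset.mem_erase.mpr ⟨hgh, Finset.mem_range.mpr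
      (Nat.lt_succ_of_le hg)⟩) (sub_self _), mul_zero, zero_mul]

/-! ### Orthogonality over the points. -/

theorem nu_pos (d : ℕ) {r : ℝ} (h1 : -1 < r) : 0 < nu d r (-r) := by
  rw [nu_eq]
  have := prod_cCoeff_pos d h1
  positivity

theorem discreteForm_uPoly {d : ℕ} {r : ℝ} (h1 : -1 < r) (h2 : r < 1) (hr : ∀ m : ℤ, r ≠ m)
    (i j : Fin (d + 1)) :
    discreteForm d (fun h => theta d r (-r) h) (fun h => kStar d r (-r) h)
      (uPoly d r (-r) i) (uPoly d r (-r) j) =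
      if i = j then nu d r (-r) / kCoeff d r (-r) i else 0 := by
  let U : Fin (d + 1) → Fin (d + 1) → ℝ := fun n h =>
    newtonSum d (dhNode d) (dhCoeff d r (n : ℕ)) (dhNode d h)
  have hν := (nu_pos d h1).ne'
  let A : Matrix (Fin (d + 1)) (Fin (d + 1)) ℝ := fun h n => U n h
  let B : Matrix (Fin (d + 1)) (Fin (d + 1)) ℝ := fun n h =>
    kCoeff d r (-r) n * U n h * kStarClosed d r h / nu d r (-r)
  have hAB : A * B = 1 := by
    ext g h
    have e := sum_kCoeff_mul_kStarClosed h1 hr (Nat.lt_succ_iff.mp g.2) (Nat.lt_succ_iff.mp h.2)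
    rw [Finset.sum_range, Finset.sum_mul] at e
    rw [Matrix.mul_apply, Matrix.one_apply]
    trans (if (g : ℕ) = h then nu d r (-r) else 0) / nu d r (-r)
    · rw [← e, Finset.sum_div]
      refine Finset.sum_congr rfl fun n _ => ?_
      simp only [A, B, U]
      ring
    · simp only [Fin.ext_iff]
      split_ifs
      · exact div_self hν
      · exact zero_div _
  -- A right inverse of a square matrix is a left inverse: summation over the index becomes
  -- summation over the points.
  have hBA := mul_eq_one_comm.mp hAB
  have e := congrFun (congrFun hBA i) j
  rw [Matrix.mul_apply, Matrix.one_apply] at e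
  have hk := (kCoeff_pos h1 h2 (Nat.lt_succ_iff.mp i.2)).ne'
  trans (if i = j then 1 else 0) * (nu d r (-r) / kCoeff d r (-r) i)
  · rw [← e, discreteForm, Finset.sum_mul]
    refine Finset.sum_congr rfl fun h _ => ?_
    rw [theta_eq_dhNode, uPoly_eval h1 h2 hr (Nat.lt_succ_iff.mp i.2),
      uPoly_eval h1 h2 hr (Nat.lt_succ_iff.mp j.2), kStar_eq hr (Nat.lt_succ_iff.mp h.2)]
    simp only [A, B, U]
    field_simp
  · split_ifs <;> simp

theorem isDiscreteOrthogonal_uPoly {d : ℕ} {r : ℝ} (h1 : -1 < r) (h2 : r < 1)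
    (hr : ∀ m : ℤ, r ≠ m) :
    IsDiscreteOrthogonal d (fun i => theta d r (-r) i) (fun i => kStar d r (-r) i)
      (fun i => uPoly d r (-r) i) where
  distinct i j hij := Fin.ext (theta_injOn d h1 (by linarith : -1 < -r)
    (by simpa using Nat.lt_succ_iff.mp i.2) (by simpa using Nat.lt_succ_iff.mp j.2) hij)
  weight_pos h := by
    rw [kStar_eq hr (Nat.lt_succ_iff.mp h.2)]
    exact kStarClosed_pos h1 h2 (Nat.lt_succ_iff.mp h.2)
  degree_eq i := degree_uPoly h1 h2 hr (Nat.lt_succ_iff.mp i.2)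
  orthogonal i j hij := by rw [discreteForm_uPoly h1 h2 hr, if_neg hij]
  norm_pos i := by
    rw [discreteForm_uPoly h1 h2 hr, if_pos rfl]
    exact div_pos (nu_pos d h1) (kCoeff_pos h1 h2 (Nat.lt_succ_iff.mp i.2))

end DualHahnRacah

theorem mainTheorem3 (d : ℕ) (r s : ℝ) (hr : -1 < r) (hs : -1 < s) (hr0 : r ≠ 0)
    (hrs : r + s = 0) :
    -- the `u_i` are the dual Hahn polynomials, after an affine change of variable
    (∀ i ≤ d, (uPoly d r s i).comp (X + C ((d : ℝ) * (d + r + s + 1))) =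
      dualHahnPoly (-s - d - 1) (-r - d - 1) d i) ∧
    -- the `u_i` are also the Racah polynomials, after an affine change of variable
    (∀ i ≤ d, (uPoly d r s i).comp (4 * X + C ((d : ℝ) * (d + 1))) =
      racahPoly (-(d : ℝ) - 1) r ((r - d - 1) / 2) (-(r + d) / 2 - 1) i) ∧
    -- the points and weights of these Racah polynomials are the `θ_i` and `k*_i`, permuted
    (∃ σ : Equiv.Perm (Fin (d + 1)), ∀ j : Fin (d + 1),
      4 * racahLattice ((r - d - 1) / 2) (-(r + d) / 2 - 1) ((j : ℕ) : ℝ) + (d : ℝ) * (d + 1) =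
          thetaBar d j ∧
      thetaBar d j = theta d r s (σ j) ∧
      racahWeight (-(d : ℝ) - 1) r ((r - d - 1) / 2) (-(r + d) / 2 - 1) j =
          kStar d r s (σ j)) ∧
    -- orthogonality on the points `θ_i` with the weights `k*_i`
    IsDiscreteOrthogonal d (fun i => theta d r s i) (fun i => kStar d r s i)
      (fun i => uPoly d r s i) ∧
    (∀ i : Fin (d + 1),
      discreteForm d (fun h => theta d r s h) (fun h => kStar d r s h)
        (uPoly d r s i) (uPoly d r s i) = nu d r s / kCoeff d r s i) ∧
    -- the explicit values at the points `θ̄_j`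
    (∀ i ≤ d, ∀ j ≤ d, (uPoly d r s i).eval (thetaBar d j) =
      hypergeom [-(i : ℝ), i - d + r, -(j : ℝ), j - d - 1 / 2]
        [-(d : ℝ), (r - d) / 2, (r - d + 1) / 2] 1) := by
  obtain rfl : s = -r := by linarith
  have h2 : r < 1 := by linarith
  have hint := ne_intCast_of_abs_lt_one hr h2 hr0
  exact ⟨fun i hi => uPoly_comp_eq_dualHahnPoly hr h2 hint hi,
    fun i hi => uPoly_comp_eq_racahPoly hr h2 hint hi,
    exists_perm_points_weights d hint,
    isDiscreteOrthogonal_uPoly hr h2 hint,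
    fun i => by rw [discreteForm_uPoly hr h2 hint, if_pos rfl],
    fun i hi j _ => uPoly_eval_thetaBar hr h2 hint hi j⟩
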